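/- Let $m_1,m_2>0$, $\alpha_1,\alpha_2>1$, $\overline\gamma_1,\overline\gamma_2>0$, $\Omega>0$. Let $N_{1},N_{2},I_{1},I_{2}$ be real random variables on a probability space such that, for $j=1,2$, the squared Nakagami-$m$ multipath coefficient $N_j^2$ has the density $$f_{N_j^2}(x)=\frac{m_j^{m_j}x^{m_j-1}}{\Omega^{m_j}\Gamma(m_j)}\exp\left(-\frac{m_jx}{\Omega}\right),\qquad x>0,$$ and the shadowing coefficient $I_j$ has the inverse-gamma density $$f_{I_j}(y)=\frac{\overline\gamma_j^{\alpha_j}}{\Gamma(\alpha_j)\,y^{\alpha_j+1}}\exp\left(-\frac{\overline\gamma_j}{y}\right),\qquad y>0.$$ Assume that $N_j$ and $I_j$ are independent for each $j=1,2$, and that $N_1^2I_1$ and $N_2^2I_2$ are independent. Put $$\gamma=N_1^2I_1N_2^2I_2,\qquad \overline\gamma=\Omega^2\,\overline\gamma_1\overline\gamma_2,\qquad \tilde\gamma=\frac{m_1m_2}{\overline\gamma},\qquad \mathcal S_1=\frac1{\Gamma(m_1)\Gamma(m_2)\Gamma(\alpha_1)\Gamma(\alpha_2)}$$ (so $\overline\gamma=\overline\gamma_1\overline\gamma_2$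 when the mean square value $\Omega$ is normalized to $1$). Then the law of $\gamma$ is absolutely continuous and has a density $f_\gamma$ that vanishes on $(-\infty,0]$ and satisfies, for every $x>0$, $$\begin{aligned}f_\gamma(x)&=\mathcal S_1\,x^{-1}\,G^{2,2}_{2,2}\left(\frac{m_1m_2x}{\overline\gamma}\,\middle|\,\begin{matrix}1-\alpha_2,\,1-\alpha_1\\ m_1,\,m_2\end{matrix}\right)\\ &=\Gamma(m_1+\alpha_2)\Gamma(m_2+\alpha_2)\Gamma(m_1+\alpha_1)\Gamma(m_2+\alpha_1)\,\mathcal S_1\;{}_2\tilde F_1\left(m_1+\alpha_2,\,m_2+\alpha_2;\,\alpha_1+\alpha_2+m_1+m_2;\,1-\frac1{\tilde\gamma x}\right)x^{-\alpha_2-1}\,\tilde\gamma^{-\alpha_2}.\end{aligned}$$ Here $G^{2,2}_{2,2}\left(z\,\middle|\,\begin{smallmatrix}a_1,a_2\\ b_1,b_2\end{smallmatrix}\right)=\frac1{2\pi i}\int_{\sigma-i\infty}^{\sigma+i\infty}\Gamma(b_1-s)\Gamma(b_2-s)\Gamma(1-a_1+s)\Gamma(1-a_2+s)\,z^s\,ds$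 is Meijer's $G$-function, with a vertical contour separating the poles of $\Gamma(b_1-s)\Gamma(b_2-s)$ from those of $\Gamma(1-a_1+s)\Gamma(1-a_2+s)$, and ${}_2\tilde F_1$ is the regularized Gauss hypergeometric function, that is, the analytic continuation to $\mathbb C\setminus[1,\infty)$ of $\sum_{n\ge0}\frac{(a)_n(b)_n}{\Gamma(c+n)\,n!}z^n$, $|z|<1$. Moreover $\gamma$ is integrable and $$\mathbb E[\gamma]=\frac{\overline\gamma}{(\alpha_1-1)(\alpha_2-1)}.$$ -/

import Mathlib

open MeasureTheory ProbabilityTheory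

/-- Density of the inverse-gamma distribution with shape `α` and scale `β`. -/
noncomputable def invGammaPDFReal (α β y : ℝ) : ℝ :=
  if 0 < y then β ^ α / (Real.Gamma α * y ^ (α + 1)) * Real.exp (-(β / y)) else 0

/-- The inverse-gamma distribution with shape `α` and scale `β`. -/
noncomputable def invGammaMeasure (α β : ℝ) : Measure ℝ :=
  volume.withDensity fun y => ENNReal.ofReal (invGammaPDFReal α β y)

/-- The Mellin–Barnes kernel of Meijer's function `G^{m,n}_{p,q}` with upper parameters
`a` and lower parameters `b`:
`∏_{j ≤ m} Γ(b_j - s) ∏_{k ≤ n} Γ(1 - a_k + s) /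
  (∏_{j > m} Γ(1 - b_j + s) ∏_{k > n} Γ(a_k - s))`. -/
noncomputable def meijerKernel (m n : ℕ) {p q : ℕ} (a : Fin p → ℂ) (b : Fin q → ℂ) (s : ℂ) : ℂ :=
  (∏ j : Fin q, if (j : ℕ) < m then Complex.Gamma (b j - s) else (Complex.Gamma (1 - b j + s))⁻¹) *
  ∏ k : Fin p, if (k : ℕ) < n then Complex.Gamma (1 - a k + s) else (Complex.Gamma (a k - s))⁻¹

/-- The vertical line `Re s = σ` separates the poles `b_j + ℓ` of `Γ(b_j - s)`, `j ≤ m`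
(which lie to its right), from the poles `a_k - 1 - ℓ` of `Γ(1 - a_k + s)`, `k ≤ n`
(which lie to its left). -/
def MeijerSeparates (m n : ℕ) {p q : ℕ} (a : Fin p → ℂ) (b : Fin q → ℂ) (σ : ℝ) : Prop :=
  (∀ j : Fin q, (j : ℕ) < m → σ < (b j).re) ∧ (∀ k : Fin p, (k : ℕ) < n → (a k).re - 1 < σ)

open Classical in
/-- Meijer's function `G^{m,n}_{p,q}(z | a; b) = (1 / 2πi) ∫_L K(s) z^s ds`, where `K` is the
Mellin–Barnes kernel and the contour `L` runs from `σ - i∞` to `σ + i∞` along a vertical line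
that separates the two families of poles. Whenever the integral converges absolutely with
exponential decay, it does not depend on the separating line. -/
noncomputable def meijerG (m n : ℕ) {p q : ℕ} (a : Fin p → ℂ) (b : Fin q → ℂ) (z : ℂ) : ℂ :=
  if h : ∃ σ : ℝ, MeijerSeparates m n a b σ then
    (1 / (2 * (Real.pi : ℂ))) * ∫ t : ℝ,
      meijerKernel m n a b ((h.choose : ℂ) + t * Complex.I) *
        z ^ ((h.choose : ℂ) + t * Complex.I)
  else 0

/-- `F` is the principal branch, on `ℂ ∖ [1, ∞)`, of the regularized Gauss hypergeometric function:
it is holomorphic there and given on the unit disc by the series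
`∑ₙ (a)ₙ (b)ₙ / (Γ(c + n) n!) zⁿ`. -/
def IsRegGaussHG (a b c : ℂ) (F : ℂ → ℂ) : Prop :=
  DifferentiableOn ℂ F {z | 1 - z ∈ Complex.slitPlane} ∧
    ∀ z : ℂ, ‖z‖ < 1 → F z = Complex.regularizedGaussHGFun a b c z

open Classical in
/-- The regularized Gauss hypergeometric function on `ℂ ∖ [1, ∞)`: the analytic continuation of
the hypergeometric series. -/
noncomputable def regGaussHG (a b c z : ℂ) : ℂ :=
  if h : ∃ F : ℂ → ℂ, IsRegGaussHG a b c F then h.choose z else 0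

/-- The analytic continuation is unique. -/
theorem IsRegGaussHG.eqOn {a b c : ℂ} {F G : ℂ → ℂ} (hF : IsRegGaussHG a b c F)
    (hG : IsRegGaussHG a b c G) : Set.EqOn F G {z | 1 - z ∈ Complex.slitPlane} := by
  have ho : IsOpen {z : ℂ | 1 - z ∈ Complex.slitPlane} :=
    Complex.isOpen_slitPlane.preimage (by fun_prop)
  have hc : IsPreconnected {z : ℂ | 1 - z ∈ Complex.slitPlane} := by
    have h := (StarConvex.isPathConnected Complex.starConvex_one_slitPlane
      (Complex.one_mem_slitPlane)).isConnected
    have h2 := h.isPreconnected.image (fun z : ℂ => 1 - z) (by fun_prop)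
    convert h2 using 1
    ext z
    constructor
    · intro hz
      exact ⟨1 - z, hz, by ring⟩
    · rintro ⟨w, hw, rfl⟩
      simpa using hw
  refine (hF.1.analyticOnNhd ho).eqOn_of_preconnected_of_eventuallyEq (hG.1.analyticOnNhd ho) hc
    (z₀ := 0) (by simp) ?_
  filter_upwards [Metric.ball_mem_nhds (0 : ℂ) one_pos] with z hz
  have hz' : ‖z‖ < 1 := by simpa using hz
  rw [hF.2 z hz', hG.2 z hz']

theorem IsRegGaussHG.regGaussHG_eq {a b c : ℂ} {F : ℂ → ℂ} (hF : IsRegGaussHG a b c F) {z : ℂ}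
    (hz : 1 - z ∈ Complex.slitPlane) : regGaussHG a b c z = F z := by
  have h : ∃ F : ℂ → ℂ, IsRegGaussHG a b c F := ⟨F, hF⟩
  rw [regGaussHG, dif_pos h]
  exact h.choose_spec.eqOn hF hz

/-! The density comes from two multiplicative convolutions, the moments from Mellin transforms. A
gamma variable times an independent inverse-gamma variable is beta prime: for a fixed product `z`,
the joint density in the gamma variable `u` is again a gamma density up to a factor, and that factor
is the beta prime density (`gammaPDFReal_mul_invGammaPDFReal`). Convolving two beta prime densities
and mapping the half-line to `(0, 1)` by `u = κ₁⁻¹ t / (1 - t)` produces Euler's integral at `1 - 1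
/ (κ₁ κ₂ x)`, where `κ₁ κ₂` is `γtil` (`betaPrimePDFReal_mul_subst`). Since Euler's integral is
holomorphic off `[1, ∞)` and agrees with the series on the unit disc, this is the hypergeometric
form (`isRegGaussHG_eulerIntegral`). For the Meijer form, independence makes the complex moment of
order `s` a product of four gamma factors and `γtil ^ (-s)` on a strip around `Re s = 0`. This is
the Mellin transform of the same density at `s + 1`, and Mellin inversion at a point of continuity
returns the Mellin–Barnes integral (`eq_meijerG_of_mellin`). The mean is the moment at `s = 1`. -/

/-! ### Euler's integral and the continuation of the hypergeometric series -/

/-- Euler's integral `∫₀¹ t^(b-1) (1-t)^(d-1) (1-zt)^(-a) dt`. -/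
noncomputable def eulerIntegral (a b d z : ℂ) : ℂ :=
  ∫ t : ℝ in (0 : ℝ)..1, (t : ℂ) ^ (b - 1) * (1 - (t : ℂ)) ^ (d - 1) * (1 - z * t) ^ (-a)

/-- The point is the convex combination `(1 - t) · 1 + t (1 - z)`, and the slit plane is star-convex
about `1`. -/
theorem one_sub_mul_mem_slitPlane {z : ℂ} (hz : 1 - z ∈ Complex.slitPlane) {t : ℝ}
    (ht : t ∈ Set.Icc (0 : ℝ) 1) : 1 - z * t ∈ Complex.slitPlane := by
  have h := Complex.starConvex_one_slitPlane hz (sub_nonneg.2 ht.2) ht.1 (by ring)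
  convert h using 1
  simp only [Complex.real_smul]
  push_cast
  ring

theorem isOpen_one_sub_mem_slitPlane : IsOpen {z : ℂ | 1 - z ∈ Complex.slitPlane} :=
  Complex.isOpen_slitPlane.preimage (by fun_prop)

theorem continuousOn_one_sub_mul_cpow {z : ℂ} (hz : 1 - z ∈ Complex.slitPlane) (a : ℂ) :
    ContinuousOn (fun t : ℝ => (1 - z * t) ^ a) (Set.Icc 0 1) :=
  ContinuousOn.cpow_const (by fun_prop) fun _ ht => one_sub_mul_mem_slitPlane hz ht

theorem intervalIntegrable_eulerIntegrand {a b d z : ℂ} (hb : 0 < b.re) (hd : 0 < d.re)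
    (hz : 1 - z ∈ Complex.slitPlane) :
    IntervalIntegrable (fun t : ℝ => (t : ℂ) ^ (b - 1) * (1 - (t : ℂ)) ^ (d - 1) *
      (1 - z * t) ^ (-a)) volume 0 1 := by
  refine (Complex.betaIntegral_convergent hb hd).mul_continuousOn ?_
  rw [Set.uIcc_of_le zero_le_one]
  exact continuousOn_one_sub_mul_cpow hz _

/-- Differentiation under the integral: the `z`-derivative of `(1 - z t) ^ (-a)` is bounded on a
compact ball times `[0, 1]`, so a multiple of the beta integrand dominates. -/
theorem differentiableOn_eulerIntegral {a b d : ℂ} (hb : 0 < b.re) (hd : 0 < d.re) :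
    DifferentiableOn ℂ (eulerIntegral a b d) {z | 1 - z ∈ Complex.slitPlane} := by
  intro z₀ hz₀
  obtain ⟨r, hr, hball⟩ := Metric.nhds_basis_closedBall.mem_iff.1
    (isOpen_one_sub_mem_slitPlane.mem_nhds hz₀)
  have hβ := Complex.betaIntegral_convergent hb hd
  have hcont : ContinuousOn
      (fun p : ℂ × ℝ => (-a) * (1 - p.1 * p.2) ^ (-a - 1) * (-(p.2 : ℂ)))
      (Metric.closedBall z₀ r ×ˢ Set.Icc (0 : ℝ) 1) := by
    refine ContinuousOn.mul (continuousOn_const.mul ?_) (by fun_prop)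
    exact ContinuousOn.cpow_const (by fun_prop) fun p hp =>
      one_sub_mul_mem_slitPlane (hball hp.1) hp.2
  obtain ⟨C, hC⟩ := ((isCompact_closedBall z₀ r).prod isCompact_Icc).exists_bound_of_continuousOn
    hcont
  have key := intervalIntegral.hasDerivAt_integral_of_dominated_loc_of_deriv_le
    (μ := volume) (a := 0) (b := 1) (x₀ := z₀) (s := Metric.closedBall z₀ r)
    (F := fun z (t : ℝ) => (t : ℂ) ^ (b - 1) * (1 - (t : ℂ)) ^ (d - 1) * (1 - z * t) ^ (-a))
    (F' := fun z (t : ℝ) => (t : ℂ) ^ (b - 1) * (1 - (t : ℂ)) ^ (d - 1) *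
      ((-a) * (1 - z * t) ^ (-a - 1) * (-(t : ℂ))))
    (bound := fun t : ℝ => ‖(t : ℂ) ^ (b - 1) * (1 - (t : ℂ)) ^ (d - 1)‖ * C)
    (Metric.closedBall_mem_nhds z₀ hr) ?_
    (intervalIntegrable_eulerIntegrand hb hd hz₀) ?_ ?_ (hβ.norm.mul_const C) ?_
  · exact key.2.differentiableAt.differentiableWithinAt
  · filter_upwards [isOpen_one_sub_mem_slitPlane.mem_nhds hz₀] with z hz
    exact (intervalIntegrable_eulerIntegrand hb hd hz).def'.aestronglyMeasurable
  · refine (hβ.mul_continuousOn (g := fun t : ℝ => (-a) * (1 - z₀ * t) ^ (-a - 1) * (-(t : ℂ)))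
      ?_).def'.aestronglyMeasurable
    rw [Set.uIcc_of_le zero_le_one]
    exact (continuousOn_const.mul (continuousOn_one_sub_mul_cpow hz₀ _)).mul (by fun_prop)
  · refine ae_of_all _ fun t ht z hz => ?_
    rw [Set.uIoc_of_le zero_le_one] at ht
    rw [norm_mul]
    exact mul_le_mul_of_nonneg_left (hC (z, t) ⟨hz, ht.1.le, ht.2⟩) (norm_nonneg _)
  · refine ae_of_all _ fun t ht z hz => ?_
    rw [Set.uIoc_of_le zero_le_one] at ht
    refine HasDerivAt.const_mul _ ?_
    have h1 : HasDerivAt (fun z : ℂ => 1 - z * t) (-(t : ℂ)) z := by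
      simpa using ((hasDerivAt_id z).mul_const (t : ℂ)).const_sub 1
    exact h1.cpow_const (one_sub_mul_mem_slitPlane (hball hz) ⟨ht.1.le, ht.2⟩)

theorem ringChoose_add_sub_one (a : ℂ) (n : ℕ) :
    Ring.choose (a + n - 1) n = (ascPochhammer ℂ n).eval a / (n.factorial : ℂ) := by
  rw [eq_div_iff (by exact_mod_cast n.factorial_ne_zero), mul_comm, ← nsmul_eq_mul,
    ← Ring.descPochhammer_eq_factorial_smul_choose,
    Polynomial.descPochhammer_smeval_eq_ascPochhammer, Polynomial.ascPochhammer_smeval_cast,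
    Polynomial.ascPochhammer_smeval_eq_eval]
  congr 1
  ring

theorem hasSum_one_sub_cpow_neg (a : ℂ) {z : ℂ} (hz : ‖z‖ < 1) :
    HasSum (fun n : ℕ => (ascPochhammer ℂ n).eval a / (n.factorial : ℂ) * z ^ n)
      ((1 - z) ^ (-a)) := by
  have h := (Complex.one_div_one_sub_cpow_hasFPowerSeriesOnBall_zero a).hasSum (y := z)
    (by simpa [enorm_eq_nnnorm, ← NNReal.coe_lt_one] using hz)
  simpa [ringChoose_add_sub_one, Complex.cpow_neg, mul_comm] using h

theorem betaIntegral_add_nat {b d : ℂ} (hb : 0 < b.re) (hd : 0 < d.re) (n : ℕ) :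
    Complex.betaIntegral (b + n) d = Complex.Gamma b * Complex.Gamma d *
      ((ascPochhammer ℂ n).eval b / Complex.Gamma (b + d + n)) := by
  have hne : Complex.Gamma (b + n + d) ≠ 0 :=
    Complex.Gamma_ne_zero_of_re_pos (by simp; positivity)
  have h := Complex.Gamma_mul_Gamma_eq_betaIntegral (s := b + n) (t := d) (by simp; positivity) hd
  have hp := Complex.Gamma_add_nat_div_Gamma_eq (n := n) b fun k hk => by
    rw [hk] at hb
    simp at hb
    linarith [k.cast_nonneg (α := ℝ)]
  rw [div_eq_iff (Complex.Gamma_ne_zero_of_re_pos hb)] at hp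
  rw [add_right_comm b d n, ← mul_div_assoc, eq_div_iff hne, mul_comm, ← h, hp]
  ring

/-- Expand `(1 - z t) ^ (-a)` in the binomial series and integrate term by term; the `n`-th term is
a beta integral with first parameter `b + n`. -/
theorem eulerIntegral_eq_of_norm_lt_one {a b d z : ℂ} (hb : 0 < b.re) (hd : 0 < d.re)
    (hz : ‖z‖ < 1) :
    eulerIntegral a b d z = Complex.Gamma b * Complex.Gamma d *
      Complex.regularizedGaussHGFun a b (b + d) z := by
  have hβ := Complex.betaIntegral_convergent hb hd
  let A : ℕ → ℂ := fun n => (ascPochhammer ℂ n).eval a / (n.factorial : ℂ) * z ^ n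
  have hA : Summable fun n => ‖A n‖ := (hasSum_one_sub_cpow_neg a hz).summable.norm
  let w : ℝ → ℂ := fun t => (t : ℂ) ^ (b - 1) * (1 - (t : ℂ)) ^ (d - 1)
  have hterm (n : ℕ) : IntervalIntegrable (fun t : ℝ => A n * (w t * (t : ℂ) ^ n)) volume 0 1 :=
    (hβ.mul_continuousOn (by fun_prop)).const_mul _
  have hsum : HasSum (fun n => ∫ t : ℝ in (0 : ℝ)..1, A n * (w t * (t : ℂ) ^ n))
      (eulerIntegral a b d z) := by
    refine intervalIntegral.hasSum_integral_of_dominated_convergence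
      (fun n t => ‖A n‖ * ‖w t‖) (fun n => (hterm n).def'.aestronglyMeasurable) ?_ ?_ ?_ ?_
    · refine fun n => ae_of_all _ fun t ht => ?_
      rw [Set.uIoc_of_le zero_le_one] at ht
      rw [norm_mul (A n), norm_mul (w t), norm_pow, Complex.norm_of_nonneg ht.1.le]
      exact mul_le_mul_of_nonneg_left
        (mul_le_of_le_one_right (norm_nonneg _) (pow_le_one₀ ht.1.le ht.2)) (norm_nonneg _)
    · exact ae_of_all _ fun t _ => hA.mul_right _
    · simp_rw [tsum_mul_right]
      exact hβ.norm.const_mul _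
    · refine ae_of_all _ fun t ht => ?_
      rw [Set.uIoc_of_le zero_le_one] at ht
      have hzt : ‖z * t‖ < 1 := by
        rw [norm_mul, Complex.norm_of_nonneg ht.1.le]
        nlinarith [norm_nonneg z, ht.1, ht.2]
      have hexp (n : ℕ) : A n * (w t * (t : ℂ) ^ n) =
          w t * ((ascPochhammer ℂ n).eval a / (n.factorial : ℂ) * (z * t) ^ n) := by
        simp only [A, mul_pow]
        ring
      simp_rw [hexp]
      exact (hasSum_one_sub_cpow_neg a hzt).mul_left (w t)
  have hval (n : ℕ) : ∫ t : ℝ in (0 : ℝ)..1, A n * (w t * (t : ℂ) ^ n) =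
      Complex.Gamma b * Complex.Gamma d *
        ((Complex.regularizedGaussHGFunSeries a b (b + d)).coeff n * z ^ n) := by
    have hB : ∫ t : ℝ in (0 : ℝ)..1, w t * (t : ℂ) ^ n = Complex.betaIntegral (b + n) d := by
      refine intervalIntegral.integral_congr_ae (ae_of_all _ fun t ht => ?_)
      rw [Set.uIoc_of_le zero_le_one] at ht
      have ht0 : (t : ℂ) ≠ 0 := by exact_mod_cast ht.1.ne'
      simp only [w]
      rw [show b + n - 1 = (b - 1) + n by ring, Complex.cpow_add _ _ ht0, Complex.cpow_natCast]
      ring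
    rw [intervalIntegral.integral_const_mul, hB, betaIntegral_add_nat hb hd,
      Complex.coeff_regularizedGaussHGFunSeries]
    simp only [A]
    field_simp
  simp_rw [hval] at hsum
  rw [← hsum.tsum_eq, tsum_mul_left, Complex.regularizedGaussHGFun, FormalMultilinearSeries.sum]
  congr 2
  ext n
  simp [mul_comm]

/-- Euler's integral representation of the regularized Gauss hypergeometric function. -/
theorem isRegGaussHG_eulerIntegral {a b d : ℂ} (hb : 0 < b.re) (hd : 0 < d.re) :
    IsRegGaussHG a b (b + d)
      fun z => (Complex.Gamma b * Complex.Gamma d)⁻¹ * eulerIntegral a b d z := by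
  refine ⟨(differentiableOn_eulerIntegral hb hd).const_mul _, fun z hz => ?_⟩
  beta_reduce
  rw [eulerIntegral_eq_of_norm_lt_one hb hd hz, inv_mul_cancel_left₀]
  exact mul_ne_zero (Complex.Gamma_ne_zero_of_re_pos hb) (Complex.Gamma_ne_zero_of_re_pos hd)

theorem IsRegGaussHG.symm {a b c : ℂ} {F : ℂ → ℂ} (hF : IsRegGaussHG a b c F) :
    IsRegGaussHG b a c F :=
  ⟨hF.1, fun z hz => by rw [hF.2 z hz, Complex.regularizedGaussHGFun_symm]⟩

/-! ### Multiplicative convolution: gamma times inverse gamma is beta prime -/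

theorem lintegral_comp_mul_left_real {u : ℝ} (hu : u ≠ 0) {F : ℝ → ENNReal} (hF : Measurable F) :
    ∫⁻ v, F (u * v) = ENNReal.ofReal |u⁻¹| * ∫⁻ z, F z := by
  rw [← lintegral_map hF (measurable_const_mul u), Real.map_volume_mul_left hu,
    lintegral_smul_measure, smul_eq_mul]

/-- The law of the product of two independent real random variables with densities `f` and `g`. -/
theorem mconv_withDensity_real {f g : ℝ → ENNReal} (hf : Measurable f) (hg : Measurable g)
    [SFinite ((volume : Measure ℝ).withDensity g)] :
    (volume.withDensity f) ∗ₘ (volume.withDensity g) =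
      volume.withDensity fun z => ∫⁻ u, f u * (g (z / u) * ENNReal.ofReal |u⁻¹|) := by
  ext A hA
  rw [← lintegral_indicator_one hA, Measure.lintegral_mconv (measurable_one.indicator hA),
    withDensity_apply _ hA, ← lintegral_indicator hA]
  have hind : Measurable (A.indicator (1 : ℝ → ENNReal)) := measurable_one.indicator hA
  have hinner (u : ℝ) : ∫⁻ v, A.indicator (1 : ℝ → ENNReal) (u * v) ∂(volume.withDensity g) =
      ∫⁻ v, g v * A.indicator (1 : ℝ → ENNReal) (u * v) := by
    rw [lintegral_withDensity_eq_lintegral_mul _ hg (by fun_prop)]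
    rfl
  simp_rw [hinner]
  rw [lintegral_withDensity_eq_lintegral_mul _ hf (by fun_prop)]
  -- The substitution `z = u v` in the inner integral needs `u ≠ 0`; the excluded point is null.
  have hu0 : ∀ᵐ u : ℝ, u ≠ 0 := by simp [ae_iff]
  calc ∫⁻ u, (f * fun u => ∫⁻ v, g v * A.indicator (1 : ℝ → ENNReal) (u * v)) u
      = ∫⁻ u, ∫⁻ z, f u * (g (z / u) * ENNReal.ofReal |u⁻¹|) *
          A.indicator (1 : ℝ → ENNReal) z := by
        refine lintegral_congr_ae ?_
        filter_upwards [hu0] with u hu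
        have h := lintegral_comp_mul_left_real hu
          (F := fun z => g (z / u) * A.indicator (1 : ℝ → ENNReal) z) (by fun_prop)
        simp only [mul_div_cancel_left₀ _ hu] at h
        rw [Pi.mul_apply, h, ← lintegral_const_mul _ (by fun_prop),
          ← lintegral_const_mul _ (by fun_prop)]
        refine lintegral_congr fun z => ?_
        ring
    _ = ∫⁻ z, ∫⁻ u, f u * (g (z / u) * ENNReal.ofReal |u⁻¹|) *
          A.indicator (1 : ℝ → ENNReal) z := by
        rw [lintegral_lintegral_swap]
        fun_prop
    _ = _ := by
        refine lintegral_congr fun z => ?_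
        by_cases hz : z ∈ A <;> simp [hz]

theorem measurable_invGammaPDFReal (α β : ℝ) : Measurable (invGammaPDFReal α β) :=
  Measurable.ite measurableSet_Ioi (by fun_prop) measurable_const

theorem invGammaPDFReal_of_nonpos {α β y : ℝ} (hy : y ≤ 0) : invGammaPDFReal α β y = 0 :=
  if_neg hy.not_gt

/-- Density of the beta prime distribution with shapes `m`, `α` and rate `κ`, that is, of
`κ⁻¹ * (G / G')` for independent unit gamma variables `G`, `G'` of shapes `m` and `α`. -/
noncomputable def betaPrimePDFReal (m α κ z : ℝ) : ℝ :=
  if 0 < z then Real.Gamma (m + α) / (Real.Gamma m * Real.Gamma α) *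
    (κ ^ m * z ^ (m - 1) * (1 + κ * z) ^ (-(m + α))) else 0

theorem measurable_betaPrimePDFReal (m α κ : ℝ) : Measurable (betaPrimePDFReal m α κ) :=
  Measurable.ite measurableSet_Ioi (by fun_prop) measurable_const

theorem betaPrimePDFReal_of_nonpos {m α κ z : ℝ} (hz : z ≤ 0) : betaPrimePDFReal m α κ z = 0 :=
  if_neg hz.not_gt

/-- The exponents combine to `-(r + β / z) u` and the powers of `u` to `u ^ (m + α - 1)`, so all
dependence on `u` sits in one normalized gamma density. -/
theorem gammaPDFReal_mul_invGammaPDFReal {m r α β z u : ℝ} (hm : 0 < m) (hr : 0 < r) (hα : 0 < α)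
    (hβ : 0 < β) (hz : 0 < z) (hu : 0 < u) :
    gammaPDFReal m r u * (invGammaPDFReal α β (z / u) * |u⁻¹|) =
      betaPrimePDFReal m α (r / β) z * gammaPDFReal (m + α) (r + β / z) u := by
  have hκ : 1 + r / β * z = (r + β / z) * (z / β) := by field_simp; ring
  have hs : 0 < r + β / z := by positivity
  rw [gammaPDFReal, gammaPDFReal, invGammaPDFReal, betaPrimePDFReal, if_pos hu.le, if_pos hu.le,
    if_pos (by positivity), if_pos hz, hκ, abs_of_pos (by positivity),
    Real.rpow_neg (by positivity), Real.mul_rpow hs.le (by positivity),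
    Real.div_rpow hr.le hβ.le, Real.div_rpow hz.le hβ.le, Real.div_rpow hz.le hu.le,
    add_mul, neg_add, Real.exp_add, Real.rpow_add hz, Real.rpow_add hβ, Real.rpow_add hz,
    Real.rpow_add hu, Real.rpow_sub hz, Real.rpow_sub hu, Real.rpow_sub hu, Real.rpow_add hu,
    show β / (z / u) = β / z * u by field_simp]
  simp only [Real.rpow_one]
  have := Real.Gamma_pos_of_pos hm
  have := Real.Gamma_pos_of_pos hα
  have := Real.Gamma_pos_of_pos (add_pos hm hα)
  field_simp

theorem betaPrimePDFReal_nonneg {m α κ : ℝ} (hm : 0 < m) (hα : 0 < α) (hκ : 0 < κ) (z : ℝ) :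
    0 ≤ betaPrimePDFReal m α κ z := by
  unfold betaPrimePDFReal
  split_ifs <;> positivity

theorem lintegral_gammaPDF_mul_invGammaPDF {m r α β : ℝ} (hm : 0 < m) (hr : 0 < r) (hα : 0 < α)
    (hβ : 0 < β) (z : ℝ) :
    ∫⁻ u, gammaPDF m r u * (ENNReal.ofReal (invGammaPDFReal α β (z / u)) *
      ENNReal.ofReal |u⁻¹|) = ENNReal.ofReal (betaPrimePDFReal m α (r / β) z) := by
  rcases le_or_gt z 0 with hz | hz
  · rw [betaPrimePDFReal_of_nonpos hz, ENNReal.ofReal_zero, ← lintegral_zero]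
    refine lintegral_congr fun u => ?_
    rcases lt_or_ge u 0 with hu | hu
    · simp [gammaPDF_of_neg hu]
    · simp [invGammaPDFReal_of_nonpos (div_nonpos_of_nonpos_of_nonneg hz hu)]
  · have hs : 0 < r + β / z := by positivity
    -- The factor `1` is written as the total mass of the gamma law with shape `m + α` and rate `r +
    -- β / z`.
    rw [← mul_one (ENNReal.ofReal _), ← lintegral_gammaPDF_eq_one (add_pos hm hα) hs,
      ← lintegral_const_mul _ (by unfold gammaPDF; fun_prop)]
    have hu0 : ∀ᵐ u : ℝ, u ≠ 0 := by simp [ae_iff]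
    refine lintegral_congr_ae ?_
    filter_upwards [hu0] with u hu
    rcases lt_or_gt_of_ne hu with hu | hu
    · simp [gammaPDF_of_neg hu]
    · rw [gammaPDF, gammaPDF, ← ENNReal.ofReal_mul' (abs_nonneg _),
        ← ENNReal.ofReal_mul (gammaPDFReal_nonneg hm hr u),
        ← ENNReal.ofReal_mul (betaPrimePDFReal_nonneg hm hα (by positivity) z),
        gammaPDFReal_mul_invGammaPDFReal hm hr hα hβ hz hu]

theorem ProbabilityTheory.HasLaw.mul_gamma_invGamma {S : Type*} [MeasurableSpace S] {P : Measure S}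
    {X Y : S → ℝ} {m r α β : ℝ} (hm : 0 < m) (hr : 0 < r) (hα : 0 < α) (hβ : 0 < β)
    (hX : HasLaw X (gammaMeasure m r) P) (hY : HasLaw Y (invGammaMeasure α β) P)
    (hXY : IndepFun X Y P) :
    HasLaw (fun ω => X ω * Y ω)
      (volume.withDensity fun z => ENNReal.ofReal (betaPrimePDFReal m α (r / β) z)) P := by
  unfold gammaMeasure at hX
  unfold invGammaMeasure at hY
  have h1 : SigmaFinite ((volume : Measure ℝ).withDensity (gammaPDF m r)) :=
    SigmaFinite.withDensity_ofReal _
  have h := hXY.hasLaw_fun_mul hX hY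
  rw [mconv_withDensity_real (by unfold gammaPDF; fun_prop)
    (measurable_invGammaPDFReal α β).ennreal_ofReal] at h
  simpa only [lintegral_gammaPDF_mul_invGammaPDF hm hr hα hβ] using h

/-! ### Product of two beta prime variables -/

/-- Density at `x > 0` of the product of two independent beta prime variables. -/
noncomputable def betaPrimeMulPDFReal (m₁ α₁ κ₁ m₂ α₂ κ₂ x : ℝ) : ℝ :=
  if 0 < x then
    Real.Gamma (m₁ + α₁) / (Real.Gamma m₁ * Real.Gamma α₁) *
    (Real.Gamma (m₂ + α₂) / (Real.Gamma m₂ * Real.Gamma α₂)) *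
    (x ^ (-α₂ - 1) * (κ₁ * κ₂) ^ (-α₂)) *
    ∫ t in Set.Ioo (0 : ℝ) 1, t ^ (m₁ + α₂ - 1) * (1 - t) ^ (α₁ + m₂ - 1) *
      (1 - (1 - 1 / (κ₁ * κ₂ * x)) * t) ^ (-(m₂ + α₂)) else 0

/-- With `u = κ₁⁻¹ t / (1 - t)`, the factor `1 + κ₁ u` becomes `1 / (1 - t)`, and `1 + κ₂ x / u`
becomes `κ₁ κ₂ x / t` times the linear factor `1 - (1 - 1 / (κ₁ κ₂ x)) t`: this is the source of the
hypergeometric argument. -/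
theorem betaPrimePDFReal_mul_subst {m₁ α₁ κ₁ m₂ α₂ κ₂ x t : ℝ} (hκ₁ : 0 < κ₁) (hκ₂ : 0 < κ₂)
    (hx : 0 < x) (ht : t ∈ Set.Ioo (0 : ℝ) 1) :
    |κ₁⁻¹ * ((1 - t) ^ 2)⁻¹| * (betaPrimePDFReal m₁ α₁ κ₁ (κ₁⁻¹ * (t / (1 - t))) *
      (betaPrimePDFReal m₂ α₂ κ₂ (x / (κ₁⁻¹ * (t / (1 - t)))) * |(κ₁⁻¹ * (t / (1 - t)))⁻¹|)) =
    Real.Gamma (m₁ + α₁) / (Real.Gamma m₁ * Real.Gamma α₁) *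
    (Real.Gamma (m₂ + α₂) / (Real.Gamma m₂ * Real.Gamma α₂)) *
    (x ^ (-α₂ - 1) * (κ₁ * κ₂) ^ (-α₂)) *
    (t ^ (m₁ + α₂ - 1) * (1 - t) ^ (α₁ + m₂ - 1) *
      (1 - (1 - 1 / (κ₁ * κ₂ * x)) * t) ^ (-(m₂ + α₂))) := by
  obtain ⟨ht0, ht1⟩ := ht
  have hs : 0 < 1 - t := sub_pos.2 ht1
  set s := 1 - t with hsdef
  have hu : 0 < κ₁⁻¹ * (t / s) := by positivity
  set q := 1 - (1 - 1 / (κ₁ * κ₂ * x)) * t with hq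
  have hq0 : 0 < q := by
    have : q = s + 1 / (κ₁ * κ₂ * x) * t := by rw [hq, hsdef]; ring
    rw [this]; positivity
  have h1 : 1 + κ₁ * (κ₁⁻¹ * (t / s)) = s⁻¹ := by
    have : t = 1 - s := by rw [hsdef]; ring
    rw [this]; field_simp; ring
  have h2 : 1 + κ₂ * (x / (κ₁⁻¹ * (t / s))) = q * (κ₁ * κ₂ * x) / t := by
    rw [hq, hsdef]
    have : 1 - t ≠ 0 := hs.ne'
    field_simp
    ring
  have h3 : x / (κ₁⁻¹ * (t / s)) = κ₁ * x * s / t := by field_simp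
  have h4 : κ₁⁻¹ * (t / s) = t / (κ₁ * s) := by field_simp
  rw [betaPrimePDFReal, betaPrimePDFReal, if_pos hu, if_pos (by positivity), h1, h2, h3, h4,
    abs_of_pos (by positivity), abs_of_pos (by positivity)]
  rw [Real.inv_rpow hs.le, Real.rpow_neg hs.le, inv_inv, Real.div_rpow ht0.le (by positivity),
    Real.div_rpow (by positivity) ht0.le, Real.div_rpow (by positivity) ht0.le,
    Real.mul_rpow hκ₁.le hs.le, Real.mul_rpow (by positivity) hs.le, Real.mul_rpow hκ₁.le hx.le,
    Real.mul_rpow hq0.le (by positivity), Real.mul_rpow (by positivity) hx.le,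
    Real.mul_rpow hκ₁.le hκ₂.le, Real.mul_rpow hκ₁.le hκ₂.le]
  simp only [neg_add, Real.rpow_add hκ₁, Real.rpow_add hκ₂, Real.rpow_add hx, Real.rpow_add hs,
    Real.rpow_add ht0, Real.rpow_sub hx, Real.rpow_sub hs, Real.rpow_sub ht0, Real.rpow_sub hκ₁,
    Real.rpow_one, Real.rpow_neg hκ₁.le, Real.rpow_neg hκ₂.le, Real.rpow_neg hx.le,
    Real.rpow_neg ht0.le]
  field_simp

theorem one_sub_mul_pos {w t : ℝ} (hw : w < 1) (ht : t ∈ Set.Ioo (0 : ℝ) 1) : 0 < 1 - w * t := by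
  nlinarith [ht.1, ht.2]

theorem one_sub_ofReal_mem_slitPlane {w : ℝ} (hw : w < 1) : 1 - (w : ℂ) ∈ Complex.slitPlane := by
  rw [← Complex.ofReal_one, ← Complex.ofReal_sub, Complex.ofReal_mem_slitPlane]
  linarith

theorem eulerIntegrand_ofReal {a b d w t : ℝ} (hw : w < 1) (ht : t ∈ Set.Ioo (0 : ℝ) 1) :
    (t : ℂ) ^ ((b : ℂ) - 1) * (1 - (t : ℂ)) ^ ((d : ℂ) - 1) * (1 - (w : ℂ) * t) ^ (-(a : ℂ)) =
      ((t ^ (b - 1) * (1 - t) ^ (d - 1) * (1 - w * t) ^ (-a) : ℝ) : ℂ) := by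
  push_cast
  rw [Complex.ofReal_cpow ht.1.le, Complex.ofReal_cpow (sub_pos.2 ht.2).le,
    Complex.ofReal_cpow (one_sub_mul_pos hw ht).le]
  push_cast
  rfl

theorem integrableOn_eulerIntegrand_ofReal {a b d w : ℝ} (hb : 0 < b) (hd : 0 < d) (hw : w < 1) :
    IntegrableOn (fun t : ℝ => t ^ (b - 1) * (1 - t) ^ (d - 1) * (1 - w * t) ^ (-a))
      (Set.Ioo 0 1) := by
  have h := intervalIntegrable_eulerIntegrand (a := a) (b := b) (d := d) (z := w) (by simpa)
    (by simpa) (one_sub_ofReal_mem_slitPlane hw)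
  rw [intervalIntegrable_iff_integrableOn_Ioo_of_le zero_le_one] at h
  have h' := (integrableOn_congr_fun (fun t ht => eulerIntegrand_ofReal hw ht)
    measurableSet_Ioo).1 h
  have h'' := h'.re
  simp only [RCLike.re_to_complex, Complex.ofReal_re] at h''
  exact h''

theorem eulerIntegral_ofReal {a b d w : ℝ} (hw : w < 1) :
    eulerIntegral a b d w =
      ((∫ t in Set.Ioo (0 : ℝ) 1, t ^ (b - 1) * (1 - t) ^ (d - 1) * (1 - w * t) ^ (-a) : ℝ) : ℂ) := by
  rw [eulerIntegral, intervalIntegral.integral_of_le zero_le_one, integral_Ioc_eq_integral_Ioo,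
    ← integral_complex_ofReal]
  exact setIntegral_congr_fun measurableSet_Ioo fun t ht => eulerIntegrand_ofReal hw ht

theorem one_sub_one_div_lt_one {y : ℝ} (hy : 0 < y) : 1 - 1 / y < 1 := by
  have : 0 < 1 / y := by positivity
  linarith

theorem betaPrimeMulPDFReal_of_nonpos {m₁ α₁ κ₁ m₂ α₂ κ₂ x : ℝ} (hx : x ≤ 0) :
    betaPrimeMulPDFReal m₁ α₁ κ₁ m₂ α₂ κ₂ x = 0 :=
  if_neg hx.not_gt

theorem betaPrimeMulPDFReal_nonneg {m₁ α₁ κ₁ m₂ α₂ κ₂ : ℝ} (hm₁ : 0 < m₁) (hα₁ : 0 < α₁)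
    (hκ₁ : 0 < κ₁) (hm₂ : 0 < m₂) (hα₂ : 0 < α₂) (hκ₂ : 0 < κ₂) (x : ℝ) :
    0 ≤ betaPrimeMulPDFReal m₁ α₁ κ₁ m₂ α₂ κ₂ x := by
  unfold betaPrimeMulPDFReal
  split_ifs with hx
  · refine mul_nonneg (by positivity) (setIntegral_nonneg measurableSet_Ioo fun t ht => ?_)
    have h1 := ht.1
    have h2 := sub_pos.2 ht.2
    have h3 := one_sub_mul_pos (one_sub_one_div_lt_one (y := κ₁ * κ₂ * x) (by positivity)) ht
    positivity
  · exact le_rfl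

theorem betaPrimeMulPDFReal_eq_regGaussHG {m₁ α₁ κ₁ m₂ α₂ κ₂ x : ℝ} (hm₁ : 0 < m₁) (hα₁ : 0 < α₁)
    (hκ₁ : 0 < κ₁) (hm₂ : 0 < m₂) (hα₂ : 0 < α₂) (hκ₂ : 0 < κ₂) (hx : 0 < x) :
    (betaPrimeMulPDFReal m₁ α₁ κ₁ m₂ α₂ κ₂ x : ℂ) =
      ((Real.Gamma (m₁ + α₂) * Real.Gamma (m₂ + α₂) * Real.Gamma (m₁ + α₁) *
        Real.Gamma (m₂ + α₁) *
        (1 / (Real.Gamma m₁ * Real.Gamma m₂ * Real.Gamma α₁ * Real.Gamma α₂)) : ℝ) : ℂ) *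
      regGaussHG ((m₁ + α₂ : ℝ) : ℂ) ((m₂ + α₂ : ℝ) : ℂ) ((α₁ + α₂ + m₁ + m₂ : ℝ) : ℂ)
        ((1 - 1 / (κ₁ * κ₂ * x) : ℝ) : ℂ) *
      ((x ^ (-α₂ - 1) * (κ₁ * κ₂) ^ (-α₂) : ℝ) : ℂ) := by
  have hw : 1 - 1 / (κ₁ * κ₂ * x) < 1 := one_sub_one_div_lt_one (by positivity)
  -- The exponent `m₁ + α₂ - 1` of `t` forces `m₁ + α₂` to be the second Euler parameter; symmetry
  -- in the first two parameters restores the stated order.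
  have hF := (isRegGaussHG_eulerIntegral (a := ((m₂ + α₂ : ℝ) : ℂ)) (b := ((m₁ + α₂ : ℝ) : ℂ))
    (d := ((α₁ + m₂ : ℝ) : ℂ)) (by rw [Complex.ofReal_re]; positivity)
    (by rw [Complex.ofReal_re]; positivity)).symm
  rw [show ((m₁ + α₂ : ℝ) : ℂ) + ((α₁ + m₂ : ℝ) : ℂ) = ((α₁ + α₂ + m₁ + m₂ : ℝ) : ℂ) by
    push_cast; ring] at hF
  rw [hF.regGaussHG_eq (one_sub_ofReal_mem_slitPlane hw), eulerIntegral_ofReal hw,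
    betaPrimeMulPDFReal, if_pos hx, Complex.Gamma_ofReal, Complex.Gamma_ofReal, add_comm α₁ m₂]
  norm_cast
  have h1 := Real.Gamma_pos_of_pos (add_pos hm₁ hα₂)
  have h2 := Real.Gamma_pos_of_pos (add_pos hm₂ hα₁)
  generalize ∫ t in Set.Ioo (0 : ℝ) 1, t ^ (m₁ + α₂ - 1) * (1 - t) ^ (m₂ + α₁ - 1) *
    (1 - (1 - 1 / (κ₁ * κ₂ * x)) * t) ^ (-(m₂ + α₂)) = J
  field_simp

/-- Needed for pointwise Mellin inversion; continuity is inherited from the holomorphy of Euler's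
integral. -/
theorem continuousAt_betaPrimeMulPDFReal {m₁ α₁ κ₁ m₂ α₂ κ₂ x : ℝ} (hm₁ : 0 < m₁) (hα₁ : 0 < α₁)
    (hκ₁ : 0 < κ₁) (hm₂ : 0 < m₂) (hα₂ : 0 < α₂) (hκ₂ : 0 < κ₂) (hx : 0 < x) :
    ContinuousAt (betaPrimeMulPDFReal m₁ α₁ κ₁ m₂ α₂ κ₂) x := by
  let F : ℂ → ℂ := eulerIntegral ((m₂ + α₂ : ℝ) : ℂ) ((m₁ + α₂ : ℝ) : ℂ) ((α₁ + m₂ : ℝ) : ℂ)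
  have hlt {y : ℝ} (hy : 0 < y) : 1 - 1 / (κ₁ * κ₂ * y) < 1 :=
    one_sub_one_div_lt_one (by positivity)
  have hF : ContinuousAt F ((1 - 1 / (κ₁ * κ₂ * x) : ℝ) : ℂ) :=
    ((differentiableOn_eulerIntegral (by rw [Complex.ofReal_re]; positivity)
      (by rw [Complex.ofReal_re]; positivity)).differentiableAt
      (isOpen_one_sub_mem_slitPlane.mem_nhds
        (one_sub_ofReal_mem_slitPlane (hlt hx)))).continuousAt
  have hin : ContinuousAt (fun y : ℝ => ((1 - 1 / (κ₁ * κ₂ * y) : ℝ) : ℂ)) x := by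
    refine Complex.continuous_ofReal.continuousAt.comp
      (continuousAt_const.sub (continuousAt_const.div (by fun_prop) (by positivity)))
  have hFre : ContinuousAt (fun y : ℝ => (F ((1 - 1 / (κ₁ * κ₂ * y) : ℝ) : ℂ)).re) x :=
    Complex.continuous_re.continuousAt.comp (ContinuousAt.comp (f := fun y : ℝ =>
      ((1 - 1 / (κ₁ * κ₂ * y) : ℝ) : ℂ)) hF hin)
  have hpow : ContinuousAt (fun y : ℝ => y ^ (-α₂ - 1)) x :=
    Real.continuousAt_rpow_const _ _ (Or.inl hx.ne')
  have hprod := (continuousAt_const (y := Real.Gamma (m₁ + α₁) / (Real.Gamma m₁ * Real.Gamma α₁) *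
    (Real.Gamma (m₂ + α₂) / (Real.Gamma m₂ * Real.Gamma α₂)))).mul
    (hpow.mul (continuousAt_const (y := (κ₁ * κ₂) ^ (-α₂)))) |>.mul hFre
  refine hprod.congr ?_
  filter_upwards [lt_mem_nhds hx] with y hy
  simp only [Pi.mul_apply]
  rw [betaPrimeMulPDFReal, if_pos hy, show F _ = _ from eulerIntegral_ofReal (hlt hy),
    Complex.ofReal_re]

theorem measurable_betaPrimeMulPDFReal {m₁ α₁ κ₁ m₂ α₂ κ₂ : ℝ} (hm₁ : 0 < m₁) (hα₁ : 0 < α₁)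
    (hκ₁ : 0 < κ₁) (hm₂ : 0 < m₂) (hα₂ : 0 < α₂) (hκ₂ : 0 < κ₂) :
    Measurable (betaPrimeMulPDFReal m₁ α₁ κ₁ m₂ α₂ κ₂) := by
  have hc : ContinuousOn (betaPrimeMulPDFReal m₁ α₁ κ₁ m₂ α₂ κ₂) (Set.Ioi 0) := fun x hx =>
    (continuousAt_betaPrimeMulPDFReal hm₁ hα₁ hκ₁ hm₂ hα₂ hκ₂ hx).continuousWithinAt
  have h := hc.measurable_piecewise (g := fun _ => (0 : ℝ)) continuousOn_const measurableSet_Ioi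
  convert h using 1
  ext x
  by_cases hx : 0 < x
  · simp [Set.piecewise, hx]
  · simp [Set.piecewise, hx, betaPrimeMulPDFReal_of_nonpos (not_lt.1 hx)]

theorem image_mul_div_one_sub_Ioo {κ : ℝ} (hκ : 0 < κ) :
    (fun t : ℝ => κ⁻¹ * (t / (1 - t))) '' Set.Ioo 0 1 = Set.Ioi 0 := by
  ext u
  constructor
  · rintro ⟨t, ht, rfl⟩
    have h1 := ht.1
    have h2 := sub_pos.2 ht.2
    exact Set.mem_Ioi.2 (by positivity)
  · intro hu
    have hu' : 0 < u := hu
    refine ⟨κ * u / (1 + κ * u), ⟨by positivity, ?_⟩, ?_⟩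
    · rw [div_lt_one (by positivity)]
      linarith
    · have h : 1 - κ * u / (1 + κ * u) = 1 / (1 + κ * u) := by field_simp; ring
      simp only [h]
      field_simp

theorem injOn_mul_div_one_sub_Ioo {κ : ℝ} (hκ : 0 < κ) :
    Set.InjOn (fun t : ℝ => κ⁻¹ * (t / (1 - t))) (Set.Ioo 0 1) := by
  intro s hs t ht h
  have h1 := (sub_pos.2 hs.2).ne'
  have h2 := (sub_pos.2 ht.2).ne'
  have h3 := mul_left_cancel₀ (inv_ne_zero hκ.ne') h
  rw [div_eq_div_iff h1 h2] at h3
  linarith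

theorem lintegral_betaPrimePDF_mul_betaPrimePDF {m₁ α₁ κ₁ m₂ α₂ κ₂ : ℝ} (hm₁ : 0 < m₁)
    (hα₁ : 0 < α₁) (hκ₁ : 0 < κ₁) (hm₂ : 0 < m₂) (hα₂ : 0 < α₂) (hκ₂ : 0 < κ₂) (x : ℝ) :
    ∫⁻ u, ENNReal.ofReal (betaPrimePDFReal m₁ α₁ κ₁ u) *
      (ENNReal.ofReal (betaPrimePDFReal m₂ α₂ κ₂ (x / u)) * ENNReal.ofReal |u⁻¹|) =
      ENNReal.ofReal (betaPrimeMulPDFReal m₁ α₁ κ₁ m₂ α₂ κ₂ x) := by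
  rcases le_or_gt x 0 with hx | hx
  · rw [betaPrimeMulPDFReal_of_nonpos hx, ENNReal.ofReal_zero, ← lintegral_zero]
    refine lintegral_congr fun u => ?_
    rcases le_or_gt u 0 with hu | hu
    · simp [betaPrimePDFReal_of_nonpos hu]
    · simp [betaPrimePDFReal_of_nonpos (div_nonpos_of_nonpos_of_nonneg hx hu.le)]
  have hw : 1 - 1 / (κ₁ * κ₂ * x) < 1 := one_sub_one_div_lt_one (by positivity)
  rw [← setLIntegral_eq_of_support_subset (s := Set.Ioi 0), ← image_mul_div_one_sub_Ioo hκ₁,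
    lintegral_image_eq_lintegral_abs_deriv_mul (f' := fun t => κ₁⁻¹ * ((1 - t) ^ 2)⁻¹)
      measurableSet_Ioo ?_ (injOn_mul_div_one_sub_Ioo hκ₁)]
  · rw [betaPrimeMulPDFReal, if_pos hx, ← integral_const_mul, ofReal_integral_eq_lintegral_ofReal]
    · refine setLIntegral_congr_fun measurableSet_Ioo fun t ht => ?_
      rw [← ENNReal.ofReal_mul' (abs_nonneg _),
        ← ENNReal.ofReal_mul (betaPrimePDFReal_nonneg hm₁ hα₁ hκ₁ _),
        ← ENNReal.ofReal_mul (abs_nonneg _), betaPrimePDFReal_mul_subst hκ₁ hκ₂ hx ht]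
    · exact (integrableOn_eulerIntegrand_ofReal (by positivity) (by positivity) hw).const_mul _
    · refine ae_restrict_of_forall_mem measurableSet_Ioo fun t ht => ?_
      have h1 := ht.1
      have h2 := sub_pos.2 ht.2
      have h3 := one_sub_mul_pos hw ht
      simp only [Pi.zero_apply]
      positivity
  · intro t ht
    have h := (sub_pos.2 ht.2).ne'
    have hd : HasDerivAt (fun t : ℝ => κ₁⁻¹ * (t / (1 - t)))
        (κ₁⁻¹ * ((1 * (1 - t) - t * (-1)) / (1 - t) ^ 2)) t :=
      ((hasDerivAt_id' t).fun_div ((hasDerivAt_id' t).const_sub 1) h).const_mul κ₁⁻¹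
    rw [show κ₁⁻¹ * ((1 * (1 - t) - t * (-1)) / (1 - t) ^ 2) = κ₁⁻¹ * ((1 - t) ^ 2)⁻¹ by ring] at hd
    exact hd.hasDerivWithinAt
  · intro u hu
    by_contra hu'
    exact hu (by simp [betaPrimePDFReal_of_nonpos (not_lt.1 hu')])

theorem ProbabilityTheory.HasLaw.mul_betaPrime {S : Type*} [MeasurableSpace S] {P : Measure S}
    {X Y : S → ℝ} {m₁ α₁ κ₁ m₂ α₂ κ₂ : ℝ} (hm₁ : 0 < m₁)
    (hα₁ : 0 < α₁) (hκ₁ : 0 < κ₁) (hm₂ : 0 < m₂) (hα₂ : 0 < α₂) (hκ₂ : 0 < κ₂)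
    (hX : HasLaw X (volume.withDensity fun z => ENNReal.ofReal (betaPrimePDFReal m₁ α₁ κ₁ z)) P)
    (hY : HasLaw Y (volume.withDensity fun z => ENNReal.ofReal (betaPrimePDFReal m₂ α₂ κ₂ z)) P)
    (hXY : IndepFun X Y P) :
    HasLaw (fun ω => X ω * Y ω)
      (volume.withDensity fun x =>
        ENNReal.ofReal (betaPrimeMulPDFReal m₁ α₁ κ₁ m₂ α₂ κ₂ x)) P := by
  have h := hXY.hasLaw_fun_mul hX hY
  rw [mconv_withDensity_real (measurable_betaPrimePDFReal _ _ _).ennreal_ofReal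
    (measurable_betaPrimePDFReal _ _ _).ennreal_ofReal] at h
  simpa only [lintegral_betaPrimePDF_mul_betaPrimePDF hm₁ hα₁ hκ₁ hm₂ hα₂ hκ₂] using h

/-! ### Complex moments as Mellin transforms -/

theorem integral_cpow_withDensity {f : ℝ → ℝ} (hf : Measurable f) (hf0 : ∀ x, 0 ≤ f x)
    (hneg : ∀ x < 0, f x = 0) (s : ℂ) :
    ∫ x, (x : ℂ) ^ s ∂(volume.withDensity fun x => ENNReal.ofReal (f x)) =
      mellin (fun t => (f t : ℂ)) (s + 1) := by
  rw [integral_withDensity_eq_integral_toReal_smul hf.ennreal_ofReal (by simp), mellin,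
    ← integral_indicator measurableSet_Ioi]
  have hu0 : ∀ᵐ u : ℝ, u ≠ 0 := by simp [ae_iff]
  refine integral_congr_ae ?_
  filter_upwards [hu0] with u hu
  rcases lt_or_gt_of_ne hu with hu | hu
  · simp [hneg u hu, hu.le]
  · rw [Set.indicator_of_mem (Set.mem_Ioi.2 hu), ENNReal.toReal_ofReal (hf0 u), Complex.real_smul,
      smul_eq_mul, add_sub_cancel_right, mul_comm]

theorem integral_cpow_gammaMeasure {m r : ℝ} (hm : 0 < m) (hr : 0 < r) {s : ℂ} (hs : -m < s.re) :
    ∫ x, (x : ℂ) ^ s ∂(gammaMeasure m r) =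
      (r : ℂ) ^ (-s) * (Complex.Gamma (m + s) / Complex.Gamma m) := by
  have h := integral_cpow_withDensity (measurable_gammaPDFReal m r) (gammaPDFReal_nonneg hm hr)
    (fun x hx => if_neg hx.not_ge) s
  refine h.trans ?_
  have hr0 : (r : ℂ) ≠ 0 := by exact_mod_cast hr.ne'
  have hre : 0 < (m + s : ℂ).re := by simp; linarith
  have hgam := Complex.integral_cpow_mul_exp_neg_mul_Ioi hre hr
  have hcongr : mellin (fun t => (gammaPDFReal m r t : ℂ)) (s + 1) =
      ∫ t : ℝ in Set.Ioi 0, (r : ℂ) ^ (m : ℂ) / Complex.Gamma m *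
        ((t : ℂ) ^ (m + s - 1 : ℂ) * Complex.exp (-(r * t))) := by
    refine setIntegral_congr_fun measurableSet_Ioi fun t ht => ?_
    have ht' : 0 < t := ht
    have ht0 : (t : ℂ) ≠ 0 := by exact_mod_cast ht'.ne'
    simp only [gammaPDFReal, if_pos ht'.le, smul_eq_mul, add_sub_cancel_right]
    push_cast
    rw [Complex.ofReal_cpow hr.le, Complex.ofReal_cpow ht'.le, ← Complex.Gamma_ofReal,
      show (m + s - 1 : ℂ) = s + (m - 1) by ring, Complex.cpow_add _ _ ht0]
    push_cast
    ring
  rw [hcongr, integral_const_mul, hgam, one_div, Complex.inv_cpow _ _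
    (by rw [Complex.arg_ofReal_of_nonneg hr.le]; exact Real.pi_pos.ne), Complex.cpow_add _ _ hr0,
    Complex.cpow_neg]
  have : (r : ℂ) ^ (m : ℂ) ≠ 0 := by simp [Complex.cpow_eq_zero_iff, hr0]
  have : (r : ℂ) ^ s ≠ 0 := by simp [Complex.cpow_eq_zero_iff, hr0]
  field_simp

theorem invGammaPDFReal_nonneg {α β : ℝ} (hα : 0 < α) (hβ : 0 < β) (x : ℝ) :
    0 ≤ invGammaPDFReal α β x := by
  unfold invGammaPDFReal
  split_ifs <;> positivity

/-- The inversion `t ↦ t⁻¹` turns the Mellin integral into the gamma integral at `α - s`. -/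
theorem integral_cpow_invGammaMeasure {α β : ℝ} (hα : 0 < α) (hβ : 0 < β) {s : ℂ}
    (hs : s.re < α) :
    ∫ x, (x : ℂ) ^ s ∂(invGammaMeasure α β) =
      (β : ℂ) ^ s * (Complex.Gamma (α - s) / Complex.Gamma α) := by
  rw [invGammaMeasure, integral_cpow_withDensity (measurable_invGammaPDFReal α β)
    (invGammaPDFReal_nonneg hα hβ) (fun x hx => invGammaPDFReal_of_nonpos hx.le) s]
  have hβ0 : (β : ℂ) ≠ 0 := by exact_mod_cast hβ.ne'
  have hre : 0 < (α - s : ℂ).re := by simp; linarith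
  have hgam := Complex.integral_cpow_mul_exp_neg_mul_Ioi hre hβ
  have hcongr : mellin (fun t => (invGammaPDFReal α β t : ℂ)) (s + 1) =
      (β : ℂ) ^ (α : ℂ) / Complex.Gamma α *
        mellin (fun t : ℝ => (fun u : ℝ => Complex.exp (-(β * u))) t⁻¹) (-(α - s)) := by
    rw [mellin, mellin, ← integral_const_mul]
    refine setIntegral_congr_fun measurableSet_Ioi fun t ht => ?_
    have ht' : 0 < t := ht
    have ht0 : (t : ℂ) ≠ 0 := by exact_mod_cast ht'.ne'
    simp only [invGammaPDFReal, if_pos ht', smul_eq_mul, add_sub_cancel_right]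
    push_cast
    rw [Complex.ofReal_cpow hβ.le, Complex.ofReal_cpow ht'.le, ← Complex.Gamma_ofReal,
      show (-(α - s) - 1 : ℂ) = s + -((α + 1 : ℝ) : ℂ) by push_cast; ring,
      Complex.cpow_add _ _ ht0, Complex.cpow_neg, div_eq_mul_inv (β : ℂ)]
    field_simp
  rw [hcongr, mellin_comp_inv (fun u : ℝ => Complex.exp (-(β * u))), neg_neg, mellin]
  simp only [smul_eq_mul]
  rw [hgam, one_div, Complex.inv_cpow _ _
    (by rw [Complex.arg_ofReal_of_nonneg hβ.le]; exact Real.pi_pos.ne), Complex.cpow_sub _ _ hβ0]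
  have : (β : ℂ) ^ (α : ℂ) ≠ 0 := by simp [Complex.cpow_eq_zero_iff, hβ0]
  have : (β : ℂ) ^ s ≠ 0 := by simp [Complex.cpow_eq_zero_iff, hβ0]
  field_simp

/-- Nonnegativity is what makes the principal power multiplicative, `(x y) ^ s = x ^ s * y ^ s`. -/
theorem ProbabilityTheory.IndepFun.integral_cpow_mul {S : Type*} [MeasurableSpace S] {P : Measure S}
    {X Y : S → ℝ} (hX : AEMeasurable X P) (hY : AEMeasurable Y P) (hX0 : ∀ᵐ ω ∂P, 0 ≤ X ω)
    (hY0 : ∀ᵐ ω ∂P, 0 ≤ Y ω) (hXY : IndepFun X Y P) (s : ℂ) :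
    ∫ ω, ((X ω * Y ω : ℝ) : ℂ) ^ s ∂P = (∫ ω, (X ω : ℂ) ^ s ∂P) * ∫ ω, (Y ω : ℂ) ^ s ∂P := by
  have hm : Measurable fun x : ℝ => (x : ℂ) ^ s := by fun_prop
  have h := (hXY.comp hm hm).integral_fun_mul_eq_mul_integral
    (hm.comp_aemeasurable hX).aestronglyMeasurable (hm.comp_aemeasurable hY).aestronglyMeasurable
  refine Eq.trans (integral_congr_ae ?_) h
  filter_upwards [hX0, hY0] with ω h1 h2
  simp only [Complex.ofReal_mul, Function.comp]
  exact Complex.mul_cpow_ofReal_nonneg h1 h2 s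

theorem ProbabilityTheory.HasLaw.integral_cpow {S : Type*} [MeasurableSpace S] {P : Measure S} {X : S → ℝ}
    {μ : Measure ℝ} (hX : HasLaw X μ P) (s : ℂ) :
    ∫ ω, (X ω : ℂ) ^ s ∂P = ∫ x, (x : ℂ) ^ s ∂μ := by
  have hm : Measurable fun x : ℝ => (x : ℂ) ^ s := by fun_prop
  exact hX.integral_comp hm.aestronglyMeasurable

theorem ProbabilityTheory.HasLaw.ae_nonneg_of_invGamma {S : Type*} [MeasurableSpace S] {P : Measure S} {Y : S → ℝ}
    {α β : ℝ} (hY : HasLaw Y (invGammaMeasure α β) P) : ∀ᵐ ω ∂P, 0 ≤ Y ω := by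
  rw [hY.ae_iff (p := fun y => 0 ≤ y) (measurableSet_setOfPred.1 measurableSet_Ici), invGammaMeasure,
    ae_withDensity_iff (measurable_invGammaPDFReal α β).ennreal_ofReal]
  refine ae_of_all _ fun y hy => ?_
  by_contra hy'
  exact hy (by simp [invGammaPDFReal_of_nonpos (not_le.1 hy').le])

theorem ProbabilityTheory.HasLaw.integral_cpow_gamma_mul_invGamma {S : Type*} [MeasurableSpace S] {P : Measure S}
    {X Y : S → ℝ} {m r α β : ℝ} (hm : 0 < m) (hr : 0 < r) (hα : 0 < α) (hβ : 0 < β)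
    (hX0 : ∀ ω, 0 ≤ X ω) (hX : HasLaw X (gammaMeasure m r) P)
    (hY : HasLaw Y (invGammaMeasure α β) P) (hXY : IndepFun X Y P) {s : ℂ} (hs : -m < s.re)
    (hs' : s.re < α) :
    ∫ ω, ((X ω * Y ω : ℝ) : ℂ) ^ s ∂P = ((r / β : ℝ) : ℂ) ^ (-s) *
      (Complex.Gamma (m + s) * Complex.Gamma (α - s) /
        (Complex.Gamma m * Complex.Gamma α)) := by
  rw [IndepFun.integral_cpow_mul hX.aemeasurable hY.aemeasurable (ae_of_all _ hX0)
    (HasLaw.ae_nonneg_of_invGamma hY) hXY, HasLaw.integral_cpow hX, HasLaw.integral_cpow hY,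
    integral_cpow_gammaMeasure hm hr hs, integral_cpow_invGammaMeasure hα hβ hs', div_eq_mul_inv r,
    Complex.ofReal_mul, Complex.mul_cpow_ofReal_nonneg hr.le (by positivity), Complex.ofReal_inv,
    Complex.inv_cpow _ _ (by rw [Complex.arg_ofReal_of_nonneg hβ.le]; exact Real.pi_pos.ne),
    Complex.cpow_neg _ s, Complex.cpow_neg _ s, inv_inv]
  ring

/-! ### Gamma bounds on vertical lines and Mellin inversion -/

theorem Complex.norm_Gamma_le_Gamma_re {w : ℂ} (hw : 0 < w.re) :
    ‖Complex.Gamma w‖ ≤ Real.Gamma w.re := by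
  rw [Complex.Gamma_eq_integral hw, Real.Gamma_eq_integral hw, Complex.GammaIntegral]
  refine (norm_integral_le_integral_norm _).trans_eq ?_
  refine setIntegral_congr_fun measurableSet_Ioi fun x hx => ?_
  have hx' : 0 < x := hx
  simp only [norm_mul, Complex.norm_cpow_eq_rpow_re_of_pos hx', Complex.sub_re, Complex.one_re]
  rw [Complex.norm_of_nonneg (Real.exp_pos _).le]

/-- From `Γ(w + 1) = w Γ(w)` one gets `‖w‖ ‖Γ(w)‖ ≤ Γ(a + 1)`, while `‖w‖ ≥ min a 1 * √(1 + w.im ^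
2)`. -/
theorem Complex.exists_norm_Gamma_le {a : ℝ} (ha : 0 < a) :
    ∃ C, ∀ w : ℂ, w.re = a → ‖Complex.Gamma w‖ ≤ C * (√(1 + w.im ^ 2))⁻¹ := by
  refine ⟨Real.Gamma (a + 1) * (min a 1)⁻¹, fun w hw => ?_⟩
  have hc : 0 < min a 1 := lt_min ha one_pos
  have hw0 : w ≠ 0 := fun h => by simp [h] at hw; exact ha.ne hw
  have hsq : 0 < √(1 + w.im ^ 2) := by positivity
  have hle : min a 1 * √(1 + w.im ^ 2) ≤ ‖w‖ := by
    refine le_of_sq_le_sq ?_ (norm_nonneg w)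
    rw [mul_pow, Real.sq_sqrt (by positivity), Complex.sq_norm, Complex.normSq_apply, hw]
    have h1 : min a 1 ^ 2 ≤ a ^ 2 := pow_le_pow_left₀ hc.le (min_le_left _ _) 2
    have h2 : min a 1 ^ 2 ≤ 1 := pow_le_one₀ hc.le (min_le_right _ _)
    nlinarith [sq_nonneg w.im]
  have hG := Complex.norm_Gamma_le_Gamma_re (w := w + 1) (by simp [hw]; linarith)
  rw [Complex.Gamma_add_one w hw0, norm_mul, Complex.add_re, Complex.one_re, hw] at hG
  rw [mul_assoc, ← mul_inv, ← div_eq_mul_inv, le_div_iff₀ (by positivity)]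
  refine le_trans ?_ hG
  rw [mul_comm]
  exact mul_le_mul_of_nonneg_right hle (norm_nonneg _)

/-- Exponential decay is not needed: two gamma factors each give `(1 + t ^ 2) ^ (-1/2)` and the
other two are bounded, so `1 / (1 + t ^ 2)` dominates up to a constant. -/
theorem verticalIntegrable_gamma_product {m₁ m₂ α₁ α₂ σ κ : ℝ} (hκ : 0 < κ) (h₁ : σ < m₁)
    (h₂ : σ < m₂) (h₃ : -α₁ < σ) (h₄ : -α₂ < σ) :
    Complex.VerticalIntegrable (fun s => (κ : ℂ) ^ s * (Complex.Gamma (m₁ - s) *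
      Complex.Gamma (m₂ - s) * (Complex.Gamma (α₂ + s) * Complex.Gamma (α₁ + s)))) σ := by
  obtain ⟨C₁, hC₁⟩ := Complex.exists_norm_Gamma_le (sub_pos.2 h₁)
  obtain ⟨C₂, hC₂⟩ := Complex.exists_norm_Gamma_le (sub_pos.2 h₂)
  have h₃' : 0 < α₁ + σ := by linarith
  have h₄' : 0 < α₂ + σ := by linarith
  have hcont {u : ℝ → ℂ} (hu : Continuous u) (hpos : ∀ t, 0 < (u t).re) :
      Continuous fun t => Complex.Gamma (u t) := by
    refine continuous_iff_continuousAt.2 fun t => ?_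
    refine ContinuousAt.comp (f := u) (Complex.differentiableAt_Gamma _ fun k hk => ?_).continuousAt
      hu.continuousAt
    have := hpos t
    rw [hk] at this
    simp at this
    linarith [k.cast_nonneg (α := ℝ)]
  have hmeas : Continuous fun t : ℝ => (κ : ℂ) ^ ((σ : ℂ) + t * Complex.I) *
      (Complex.Gamma (m₁ - (σ + t * Complex.I)) * Complex.Gamma (m₂ - (σ + t * Complex.I)) *
      (Complex.Gamma (α₂ + (σ + t * Complex.I)) * Complex.Gamma (α₁ + (σ + t * Complex.I)))) := by
    refine Continuous.mul (Continuous.const_cpow (by fun_prop) (Or.inl (by exact_mod_cast hκ.ne')))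
      (((hcont (by fun_prop) ?_).mul (hcont (by fun_prop) ?_)).mul
        ((hcont (by fun_prop) ?_).mul (hcont (by fun_prop) ?_)))
    all_goals intro t; simp; linarith
  refine Integrable.mono' (integrable_inv_one_add_sq.const_mul
    (κ ^ σ * (C₁ * C₂ * (Real.Gamma (α₂ + σ) * Real.Gamma (α₁ + σ)))))
    hmeas.aestronglyMeasurable (ae_of_all _ fun t => ?_)
  have e₁ := hC₁ (m₁ - (σ + t * Complex.I)) (by simp)
  have e₂ := hC₂ (m₂ - (σ + t * Complex.I)) (by simp)
  have e₃ := Complex.norm_Gamma_le_Gamma_re (w := α₁ + (σ + t * Complex.I)) (by simpa)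
  have e₄ := Complex.norm_Gamma_le_Gamma_re (w := α₂ + (σ + t * Complex.I)) (by simpa)
  simp at e₁ e₂ e₃ e₄
  rw [norm_mul, norm_mul, norm_mul, norm_mul, Complex.norm_cpow_eq_rpow_re_of_pos hκ]
  have hsq : (√(1 + t ^ 2))⁻¹ * (√(1 + t ^ 2))⁻¹ = (1 + t ^ 2)⁻¹ := by
    rw [← mul_inv, Real.mul_self_sqrt (by positivity)]
  have hre : ((σ : ℂ) + t * Complex.I).re = σ := by simp
  rw [hre]
  calc _ ≤ κ ^ σ * ((C₁ * (√(1 + t ^ 2))⁻¹) * (C₂ * (√(1 + t ^ 2))⁻¹) *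
        (Real.Gamma (α₂ + σ) * Real.Gamma (α₁ + σ))) := by
        refine mul_le_mul_of_nonneg_left ?_ (by positivity)
        refine mul_le_mul (mul_le_mul e₁ e₂ (norm_nonneg _) ((norm_nonneg _).trans e₁))
          (mul_le_mul e₄ e₃ (norm_nonneg _) ((norm_nonneg _).trans e₄)) (by positivity) ?_
        exact mul_nonneg ((norm_nonneg _).trans e₁) ((norm_nonneg _).trans e₂)
    _ = _ := by rw [← hsq]; ring

theorem meijerKernel_two_two (a₁ a₂ b₁ b₂ s : ℂ) :
    meijerKernel 2 2 ![1 - a₁, 1 - a₂] ![b₁, b₂] s =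
      Complex.Gamma (b₁ - s) * Complex.Gamma (b₂ - s) *
        (Complex.Gamma (a₁ + s) * Complex.Gamma (a₂ + s)) := by
  simp [meijerKernel, Fin.prod_univ_two]

/-- A function whose Mellin transform is a product of four gamma factors is given by Meijer's
function `G^{2,2}_{2,2}`. -/
theorem eq_meijerG_of_mellin {f : ℝ → ℝ} {m₁ m₂ α₁ α₂ κ C x : ℝ} (hm₁ : 0 < m₁) (hm₂ : 0 < m₂)
    (hα₁ : 0 < α₁) (hα₂ : 0 < α₂) (hκ : 0 < κ) (hC : C ≠ 0) (hx : 0 < x) (hf : ContinuousAt f x)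
    (hmellin : ∀ s : ℂ, -m₁ < s.re → -m₂ < s.re → s.re < α₁ → s.re < α₂ →
      mellin (fun t => (f t : ℂ)) (s + 1) = C * ((κ : ℂ) ^ (-s) *
        (Complex.Gamma (m₁ + s) * Complex.Gamma (m₂ + s) *
          (Complex.Gamma (α₂ - s) * Complex.Gamma (α₁ - s))))) :
    (f x : ℂ) = ((x⁻¹ * C : ℝ) : ℂ) *
      meijerG 2 2 ![1 - (α₂ : ℂ), 1 - (α₁ : ℂ)] ![(m₁ : ℂ), (m₂ : ℂ)] ((κ * x : ℝ) : ℂ) := by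
  -- The line `Re s = 0` separates because all four parameters are positive. The line used by
  -- `meijerG` is an arbitrary choice; only its separating inequalities enter below.
  have hex : ∃ σ : ℝ, MeijerSeparates 2 2 ![1 - (α₂ : ℂ), 1 - (α₁ : ℂ)] ![(m₁ : ℂ), (m₂ : ℂ)] σ :=
    ⟨0, by simp [MeijerSeparates, Fin.forall_fin_two, hm₁, hm₂, hα₁, hα₂]⟩
  rw [meijerG, dif_pos hex]
  have hsep := hex.choose_spec
  set σ := hex.choose
  simp only [MeijerSeparates, Fin.forall_fin_two] at hsep
  obtain ⟨⟨h₁, h₂⟩, h₃, h₄⟩ := hsep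
  simp at h₁ h₂ h₃ h₄
  -- The factor `t` absorbs the shift `s + 1`, and the inversion `t ↦ t⁻¹` replaces `s` by `-s`,
  -- matching the kernel's `z ^ s` with the `x ^ (-s)` of Mellin inversion.
  let g : ℝ → ℂ := fun t => (t : ℂ) ^ (1 : ℂ) • (f t : ℂ)
  let h : ℝ → ℂ := fun t => g t⁻¹
  have hh (s : ℂ) (hs : s.re = σ) : mellin h s = C * ((κ : ℂ) ^ s * (Complex.Gamma (m₁ - s) *
      Complex.Gamma (m₂ - s) * (Complex.Gamma (α₂ + s) * Complex.Gamma (α₁ + s)))) := by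
    rw [show mellin h s = mellin g (-s) from mellin_comp_inv g s, mellin_cpow_smul,
      hmellin (-s) (by rw [Complex.neg_re]; linarith) (by rw [Complex.neg_re]; linarith)
        (by rw [Complex.neg_re]; linarith) (by rw [Complex.neg_re]; linarith)]
    simp only [neg_neg, ← sub_eq_add_neg, sub_neg_eq_add]
  have hκ0 : (κ : ℂ) ≠ 0 := by exact_mod_cast hκ.ne'
  have hC0 : (C : ℂ) ≠ 0 := by exact_mod_cast hC
  have hx0 : (x : ℂ) ≠ 0 := by exact_mod_cast hx.ne'
  -- A divergent Bochner integral has value `0`, so the nonvanishing of the gamma product already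
  -- gives convergence.
  have hconv : MellinConvergent h σ := by
    refine Integrable.of_integral_ne_zero ?_
    change mellin h σ ≠ 0
    rw [hh σ (Complex.ofReal_re σ)]
    refine mul_ne_zero hC0 (mul_ne_zero (by simp [Complex.cpow_eq_zero_iff, hκ0])
      (mul_ne_zero (mul_ne_zero ?_ ?_) (mul_ne_zero ?_ ?_))) <;>
    · refine Complex.Gamma_ne_zero_of_re_pos ?_
      simp
      linarith
  have hline (y : ℝ) : ((σ : ℂ) + y * Complex.I).re = σ := by simp
  have hvert : Complex.VerticalIntegrable (mellin h) σ := by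
    have hv := (verticalIntegrable_gamma_product (α₁ := α₁) (α₂ := α₂) hκ h₁ h₂ (by linarith)
      (by linarith)).const_mul (C : ℂ)
    refine hv.congr (ae_of_all _ fun y => ?_)
    exact (hh _ (hline y)).symm
  have hcont : ContinuousAt h x⁻¹ := by
    have h1 : ContinuousAt g (x⁻¹)⁻¹ := by
      rw [inv_inv]
      simp only [g, Complex.cpow_one, smul_eq_mul]
      exact Complex.continuous_ofReal.continuousAt.mul
        (ContinuousAt.comp (f := f) Complex.continuous_ofReal.continuousAt hf)
    exact ContinuousAt.comp (f := fun t : ℝ => t⁻¹) h1 (continuousAt_inv₀ (inv_ne_zero hx.ne'))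
  have key := mellinInv_mellin_eq σ h (inv_pos.2 hx) hconv hvert hcont
  have hval : h x⁻¹ = x * f x := by simp [h, g]
  have hgam (y : ℝ) : ((x⁻¹ : ℝ) : ℂ) ^ (-((σ : ℂ) + y * Complex.I)) •
      mellin h ((σ : ℂ) + y * Complex.I) =
      C * (meijerKernel 2 2 ![1 - (α₂ : ℂ), 1 - (α₁ : ℂ)] ![(m₁ : ℂ), (m₂ : ℂ)]
        ((σ : ℂ) + y * Complex.I) * ((κ * x : ℝ) : ℂ) ^ ((σ : ℂ) + y * Complex.I)) := by
    rw [hh _ (hline y), meijerKernel_two_two, Complex.ofReal_inv, Complex.inv_cpow _ _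
      (by rw [Complex.arg_ofReal_of_nonneg hx.le]; exact Real.pi_pos.ne), Complex.cpow_neg, inv_inv,
      Complex.ofReal_mul, Complex.mul_cpow_ofReal_nonneg hκ.le hx.le, smul_eq_mul]
    ring
  rw [hval, mellinInv] at key
  simp_rw [hgam] at key
  rw [integral_const_mul, Complex.real_smul] at key
  rw [← mul_right_inj' hx0, ← key]
  generalize ∫ y : ℝ, meijerKernel 2 2 ![1 - (α₂ : ℂ), 1 - (α₁ : ℂ)] ![(m₁ : ℂ), (m₂ : ℂ)]
    ((σ : ℂ) + y * Complex.I) * ((κ * x : ℝ) : ℂ) ^ ((σ : ℂ) + y * Complex.I) = J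
  push_cast
  field_simp

theorem integrable_of_integral_ofReal_ne_zero {S : Type*} [MeasurableSpace S] {P : Measure S}
    {X : S → ℝ} (h : ∫ ω, (X ω : ℂ) ∂P ≠ 0) : Integrable X P := by
  have := (Integrable.of_integral_ne_zero h).re
  simpa using this

/-! ### Density, closed forms and mean of the product -/

theorem mainTheorem2 {S : Type*} [MeasurableSpace S] (P : Measure S) [IsProbabilityMeasure P]
    (m₁ m₂ α₁ α₂ γ₁ γ₂ Ω : ℝ)
    (hm₁ : 0 < m₁) (hm₂ : 0 < m₂) (hα₁ : 1 < α₁) (hα₂ : 1 < α₂)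
    (hγ₁ : 0 < γ₁) (hγ₂ : 0 < γ₂) (hΩ : 0 < Ω)
    (N₁ N₂ I₁ I₂ : S → ℝ)
    (hN₁ : HasLaw (fun ω => N₁ ω ^ 2) (gammaMeasure m₁ (m₁ / Ω)) P)
    (hN₂ : HasLaw (fun ω => N₂ ω ^ 2) (gammaMeasure m₂ (m₂ / Ω)) P)
    (hI₁ : HasLaw I₁ (invGammaMeasure α₁ γ₁) P)
    (hI₂ : HasLaw I₂ (invGammaMeasure α₂ γ₂) P)
    (hNI₁ : IndepFun N₁ I₁ P) (hNI₂ : IndepFun N₂ I₂ P)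
    (hM : IndepFun (fun ω => N₁ ω ^ 2 * I₁ ω) (fun ω => N₂ ω ^ 2 * I₂ ω) P)
    (γbar γtil S₁ : ℝ)
    (hγbar : γbar = Ω ^ 2 * (γ₁ * γ₂))
    (hγtil : γtil = m₁ * m₂ / γbar)
    (hS₁ : S₁ = 1 / (Real.Gamma m₁ * Real.Gamma m₂ * Real.Gamma α₁ * Real.Gamma α₂)) :
    (∃ f : ℝ → ℝ, Measurable f ∧ (∀ x, 0 ≤ f x) ∧ (∀ x ≤ 0, f x = 0) ∧
      HasLaw (fun ω => N₁ ω ^ 2 * I₁ ω * (N₂ ω ^ 2 * I₂ ω))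
        (volume.withDensity fun x => ENNReal.ofReal (f x)) P ∧
      ∀ x : ℝ, 0 < x →
        (f x : ℂ) = ((x⁻¹ * S₁ : ℝ) : ℂ) *
          meijerG 2 2 ![1 - (α₂ : ℂ), 1 - (α₁ : ℂ)] ![(m₁ : ℂ), (m₂ : ℂ)]
            ((m₁ * m₂ * x / γbar : ℝ) : ℂ) ∧
        (f x : ℂ) =
          ((Real.Gamma (m₁ + α₂) * Real.Gamma (m₂ + α₂) * Real.Gamma (m₁ + α₁) *
            Real.Gamma (m₂ + α₁) * S₁ : ℝ) : ℂ) *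
          regGaussHG ((m₁ + α₂ : ℝ) : ℂ) ((m₂ + α₂ : ℝ) : ℂ) ((α₁ + α₂ + m₁ + m₂ : ℝ) : ℂ)
            ((1 - 1 / (γtil * x) : ℝ) : ℂ) *
          ((x ^ (-α₂ - 1) * γtil ^ (-α₂) : ℝ) : ℂ)) ∧
    Integrable (fun ω => N₁ ω ^ 2 * I₁ ω * (N₂ ω ^ 2 * I₂ ω)) P ∧
    ∫ ω, N₁ ω ^ 2 * I₁ ω * (N₂ ω ^ 2 * I₂ ω) ∂P = γbar / ((α₁ - 1) * (α₂ - 1)) := by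
  have hα₁' : 0 < α₁ := by linarith
  have hα₂' : 0 < α₂ := by linarith
  have hr₁ : 0 < m₁ / Ω := by positivity
  have hr₂ : 0 < m₂ / Ω := by positivity
  have hκ₁ : 0 < m₁ / Ω / γ₁ := by positivity
  have hκ₂ : 0 < m₂ / Ω / γ₂ := by positivity
  have hsq : Measurable fun x : ℝ => x ^ 2 := by fun_prop
  have hi₁ : IndepFun (fun ω => N₁ ω ^ 2) I₁ P := hNI₁.comp hsq measurable_id
  have hi₂ : IndepFun (fun ω => N₂ ω ^ 2) I₂ P := hNI₂.comp hsq measurable_id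
  have hX₁ := HasLaw.mul_gamma_invGamma hm₁ hr₁ hα₁' hγ₁ hN₁ hI₁ hi₁
  have hX₂ := HasLaw.mul_gamma_invGamma hm₂ hr₂ hα₂' hγ₂ hN₂ hI₂ hi₂
  have hlaw := HasLaw.mul_betaPrime hm₁ hα₁' hκ₁ hm₂ hα₂' hκ₂ hX₁ hX₂ hM
  have hκ : m₁ / Ω / γ₁ * (m₂ / Ω / γ₂) = γtil := by
    rw [hγtil, hγbar]; field_simp
  have hγtil0 : 0 < γtil := by rw [← hκ]; positivity
  have hS₁0 : S₁ ≠ 0 := by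
    rw [hS₁]
    have := Real.Gamma_pos_of_pos hm₁
    have := Real.Gamma_pos_of_pos hm₂
    have := Real.Gamma_pos_of_pos hα₁'
    have := Real.Gamma_pos_of_pos hα₂'
    positivity
  have hX0₁ : ∀ᵐ ω ∂P, 0 ≤ N₁ ω ^ 2 * I₁ ω := by
    filter_upwards [HasLaw.ae_nonneg_of_invGamma hI₁] with ω hω
    positivity
  have hX0₂ : ∀ᵐ ω ∂P, 0 ≤ N₂ ω ^ 2 * I₂ ω := by
    filter_upwards [HasLaw.ae_nonneg_of_invGamma hI₂] with ω hω
    positivity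
  have hmoment (s : ℂ) (h₁ : -m₁ < s.re) (h₂ : -m₂ < s.re) (h₃ : s.re < α₁) (h₄ : s.re < α₂) :
      ∫ ω, ((N₁ ω ^ 2 * I₁ ω * (N₂ ω ^ 2 * I₂ ω) : ℝ) : ℂ) ^ s ∂P =
        S₁ * ((γtil : ℂ) ^ (-s) * (Complex.Gamma (m₁ + s) * Complex.Gamma (m₂ + s) *
          (Complex.Gamma (α₂ - s) * Complex.Gamma (α₁ - s)))) := by
    rw [IndepFun.integral_cpow_mul hX₁.aemeasurable hX₂.aemeasurable hX0₁ hX0₂ hM,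
      HasLaw.integral_cpow_gamma_mul_invGamma hm₁ hr₁ hα₁' hγ₁ (fun ω => sq_nonneg _) hN₁ hI₁ hi₁
        h₁ h₃,
      HasLaw.integral_cpow_gamma_mul_invGamma hm₂ hr₂ hα₂' hγ₂ (fun ω => sq_nonneg _) hN₂ hI₂ hi₂
        h₂ h₄, ← hκ, Complex.ofReal_mul (m₁ / Ω / γ₁), Complex.mul_cpow_ofReal_nonneg hκ₁.le hκ₂.le,
      hS₁]
    push_cast
    simp only [← Complex.Gamma_ofReal]
    ring
  have hfm := measurable_betaPrimeMulPDFReal hm₁ hα₁' hκ₁ hm₂ hα₂' hκ₂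
  have hf0 := betaPrimeMulPDFReal_nonneg hm₁ hα₁' hκ₁ hm₂ hα₂' hκ₂
  have hmean : ∫ ω, ((N₁ ω ^ 2 * I₁ ω * (N₂ ω ^ 2 * I₂ ω) : ℝ) : ℂ) ∂P =
      ((γbar / ((α₁ - 1) * (α₂ - 1)) : ℝ) : ℂ) := by
    -- The order `s = 1` lies in the strip exactly because `α₁` and `α₂` exceed `1`.
    have h := hmoment 1 (by simp; linarith) (by simp; linarith) (by simpa) (by simpa)
    simp only [Complex.cpow_one] at h
    have hΓ (a : ℝ) (ha : 0 < a) : Complex.Gamma (a + 1) = a * Complex.Gamma a :=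
      Complex.Gamma_add_one _ (by exact_mod_cast ha.ne')
    have hΓ' (a : ℝ) (ha : 1 < a) :
        Complex.Gamma (a - 1) = Real.Gamma a / (a - 1 : ℝ) := by
      have := Real.Gamma_add_one (sub_pos.2 ha).ne'
      rw [sub_add_cancel] at this
      rw [this, ← Complex.ofReal_one, ← Complex.ofReal_sub, Complex.Gamma_ofReal, ←
        Complex.ofReal_div, mul_div_cancel_left₀ _ (sub_pos.2 ha).ne']
    rw [h, hΓ _ hm₁, hΓ _ hm₂, hΓ' _ hα₁, hΓ' _ hα₂, Complex.cpow_neg_one, hS₁, hγtil]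
    simp only [Complex.Gamma_ofReal]
    norm_cast
    have := sub_pos.2 hα₁
    have := sub_pos.2 hα₂
    have := Real.Gamma_pos_of_pos hm₁
    have := Real.Gamma_pos_of_pos hm₂
    have := Real.Gamma_pos_of_pos hα₁'
    have := Real.Gamma_pos_of_pos hα₂'
    have : 0 < γbar := by rw [hγbar]; positivity
    field_simp
  refine ⟨⟨_, hfm, hf0, fun x hx => betaPrimeMulPDFReal_of_nonpos hx, hlaw, fun x hx => ⟨?_, ?_⟩⟩,
    ?_, ?_⟩
  · rw [show m₁ * m₂ * x / γbar = γtil * x by rw [hγtil]; ring]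
    refine eq_meijerG_of_mellin hm₁ hm₂ hα₁' hα₂' hγtil0 hS₁0 hx
      (continuousAt_betaPrimeMulPDFReal hm₁ hα₁' hκ₁ hm₂ hα₂' hκ₂ hx) fun s h₁ h₂ h₃ h₄ => ?_
    rw [← hmoment s h₁ h₂ h₃ h₄, HasLaw.integral_cpow hlaw,
      integral_cpow_withDensity hfm hf0 fun x hx => betaPrimeMulPDFReal_of_nonpos hx.le]
  · rw [betaPrimeMulPDFReal_eq_regGaussHG hm₁ hα₁' hκ₁ hm₂ hα₂' hκ₂ hx, hκ, hS₁]
  -- Integrability is read off from the nonzero mean, since the integral of a non-integrable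
  -- function is `0` by convention.
  · refine integrable_of_integral_ofReal_ne_zero ?_
    rw [hmean]
    have : 0 < γbar := by rw [hγbar]; positivity
    have h1 := sub_pos.2 hα₁
    have h2 := sub_pos.2 hα₂
    exact_mod_cast (by positivity : γbar / ((α₁ - 1) * (α₂ - 1)) ≠ 0)
  · rw [integral_complex_ofReal] at hmean
    exact_mod_cast hmean
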